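/- Let $(E,d)$ be a metric space with a $\sigma$-algebra for which $d$ is (jointly) measurable, e.g. the Borel $\sigma$-algebra of a separable $E$. Let $(X_n)_{n\in\mathbb Z}$ be a stationary $E$-valued Markov chain with transition kernel $p$, one-dimensional marginal $\nu$ and path law $\mathbb P_\nu$ on $E^{\mathbb Z}$, whose remote past is trivial: every $A\in\bigcap_{i\in\mathbb Z}\sigma(X_k:k\le i)$ has $\mathbb P_\nu(A)\in\{0,1\}$ (in particular the chain is ergodic). Let $(\hat{\mathbb P}_{x,y})_{x,y\in E}$, measurable in $(x,y)$, be a Markovian coupling: under $\hat{\mathbb P}_{x,y}$ the pair process $(u_n,v_n)_{n\ge 0}$ is a Markov chain started at $(x,y)$, with a transition kernel on $E\times E$ not depending on $(x,y)$, and $(u_n)_{n\ge0}$, $(v_n)_{n\ge0}$ are Markov chains with kernel $p$ started at $x$ and at $y$. Let $\hat{\mathbb E}_{x,y}$ be the corresponding expectation and let $\tau=\sum_{j\ge 0}d(u_j,v_j)\in[0,\infty]$ be the generalized coupling time. For $f:E^{\mathbb Z}\to\mathbb R$ and $i\in\mathbb Z$ put $$\delta_i(f)=\sup\Big\{\frac{f(\overline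 x)-f(\overline y)}{d(x_i,y_i)}:\ x_j=y_j\ \forall j\ne i,\ x_i\ne y_i\Big\},\qquad \|\delta(f)\|_2^2=\sum_{i\in\mathbb Z}\delta_i(f)^2\in[0,\infty]$$ (a supremum over the empty set being $0$). Let $f\in L^2(\mathbb P_\nu)$ be measurable with $\delta_i(f)<\infty$ for every $i$, and suppose that $f$ does not depend on the coordinates at $+\infty$, in the following sense: for all $\overline x,\overline y\in E^{\mathbb Z}$ with $\sum_{i}\delta_i(f)\,d(x_i,y_i)<\infty$, $$f(\ldots,x_{n-1},x_n,y_{n+1},y_{n+2},\ldots)\longrightarrow f(\overline x)\qquad(n\to\infty).$$ (This holds if $f$ depends on finitely many coordinates, if $f$ is continuous for the product topology, or if $|f(\overline x)-f(\overline y)|\le\sum_i\delta_i(f)\,d(x_i,y_i)$ for all $\overline x,\overline y$.) Then $$\operatorname{Var}(f)\le C\,\|\delta(f)\|_2^2,\qquad C=\int\nu(dx)\int p(x,dz)\int p(x,dy)\int p(x,du)\ \hat{\mathbb E}_{z,y}(\tau)\,\hat{\mathbb E}_{z,u}(\tau)\in[0,\infty],$$ and consequently, for every $t>0$, $$\mathbb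 P_\nu\big(|f-\mathbb E f|\ge t\big)\le C\,\frac{\|\delta(f)\|_2^2}{t^2}.$$ Here $0\cdot\infty=0$. -/

import Mathlib

open MeasureTheory ProbabilityTheory Filter Topology
open scoped ENNReal

namespace CouplingConcentration

section Chains

variable {S ι : Type*} [MeasurableSpace S]

/-- The sigma-field generated by the coordinates `X_k`, `k ≤ i`, on the path space `ι → S`. -/
@[reducible] def past [Preorder ι] (i : ι) : MeasurableSpace (ι → S) :=
  ⨆ k : ι, ⨆ _ : k ≤ i, MeasurableSpace.comap (fun x : ι → S => x k) inferInstance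

/-- Under the law `Q` on paths, the coordinate process is a Markov chain with transition kernel
`κ`: the conditional distribution of `X_{i+1}` given the sigma-field of `(X_k)_{k ≤ i}`
is `κ (X_i, ·)`. Used for the index sets `ℤ` and `ℕ`. -/
def IsMarkovChain [Preorder ι] [Add ι] [One ι] (κ : Kernel S S) (Q : Measure (ι → S)) : Prop :=
  ∀ (i : ι) (A : Set (ι → S)), MeasurableSet[past i] A → ∀ B : Set S, MeasurableSet B →
    Q (A ∩ {x | x (i + 1) ∈ B}) = ∫⁻ x in A, κ (x i) B ∂Q

/-- `Q` is the law of `(X_n)_{n ≥ 0}`, the Markov chain with kernel `κ` started at `X_0 = s`. -/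
structure IsMarkovChainFrom (κ : Kernel S S) (s : S) (Q : Measure (ℕ → S)) : Prop where
  start : Q.map (fun x => x 0) = Measure.dirac s
  markov : IsMarkovChain κ Q

/-- `P` is the law of a two-sided stationary Markov chain with transition kernel `p`
and one-dimensional marginal `ν`. -/
structure IsStationaryMarkovChain (p : Kernel S S) (ν : Measure S) (P : Measure (ℤ → S)) :
    Prop where
  stationary : P.map (fun x i => x (i + 1)) = P
  marginal : P.map (fun x => x 0) = ν
  markov : IsMarkovChain p P

/-- Triviality of the tail sigma-field `⋂ i, σ(X_k : k ≤ i)` of the remote past. -/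
def TailTrivial (P : Measure (ℤ → S)) : Prop :=
  ∀ A : Set (ℤ → S), MeasurableSet[⨅ i : ℤ, past i] A → P A = 0 ∨ P A = 1

/-- `Q (x, y)` is the law on paths of pairs of a Markovian coupling of the Markov chains with
kernel `p` started at `x` and at `y`: the pair process is itself a Markov chain started at
`(x, y)`, and its two components are Markov chains with kernel `p` started at `x` and `y`. -/
structure IsMarkovianCoupling (p : Kernel S S) (Q : Kernel (S × S) (ℕ → S × S)) : Prop where
  markov : ∃ q : Kernel (S × S) (S × S), IsMarkovKernel q ∧
    ∀ z : S × S, IsMarkovChainFrom q z (Q z)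
  left : ∀ x y : S, IsMarkovChainFrom p x ((Q (x, y)).map (fun w n => (w n).1))
  right : ∀ x y : S, IsMarkovChainFrom p y ((Q (x, y)).map (fun w n => (w n).2))

end Chains

section Metric

variable {E : Type*} [MetricSpace E]

/-- The `i`-th Lipschitz constant of `f`, the supremum of `|f x - f y| / d (x_i, y_i)` over all
`x`, `y` that differ exactly at the coordinate `i`. -/
noncomputable def lipConst (f : (ℤ → E) → ℝ) (i : ℤ) : ℝ≥0∞ :=
  ⨆ (x : ℤ → E) (y : ℤ → E) (_ : ∀ j, j ≠ i → x j = y j) (_ : x i ≠ y i),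
    edist (f x) (f y) / edist (x i) (y i)

/-- `f` is Lipschitz in all coordinates. -/
def IsCoordLipschitz (f : (ℤ → E) → ℝ) : Prop :=
  ∀ i : ℤ, lipConst f i < ∞

/-- `f` is insensitive to the coordinates near `+∞`: `f (…, x_{n-1}, x_n, y_{n+1}, y_{n+2}, …)`
tends to `f x` whenever `∑ i, δ_i(f) d(x_i, y_i) < ∞`. Every `f` that is continuous for the
product topology has this property, and so has every `f` with
`|f x - f y| ≤ ∑ i, δ_i(f) d(x_i, y_i)` for all `x`, `y`. -/
def ContinuousAtInfinity (f : (ℤ → E) → ℝ) : Prop :=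
  ∀ x y : ℤ → E, ∑' i : ℤ, lipConst f i * edist (x i) (y i) < ∞ →
    Tendsto (fun n : ℕ => f (fun i => if i ≤ (n : ℤ) then x i else y i)) atTop (𝓝 (f x))

/-- `‖δ(f)‖₂²`. -/
noncomputable def lipNormSq (f : (ℤ → E) → ℝ) : ℝ≥0∞ :=
  ∑' i : ℤ, lipConst f i ^ 2

/-- The generalized coupling time `τ = ∑ j, d (u_j, v_j)` of a path of pairs `(u_j, v_j)`. -/
noncomputable def couplingTime (w : ℕ → E × E) : ℝ≥0∞ :=
  ∑' j : ℕ, edist (w j).1 (w j).2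

variable [MeasurableSpace E]

/-- The expectation of the generalized coupling time for the coupling started at `(x, y)`. -/
noncomputable def meanCouplingTime (Q : Kernel (E × E) (ℕ → E × E)) (x y : E) : ℝ≥0∞ :=
  ∫⁻ w, couplingTime w ∂(Q (x, y))

/-- The constant
`∫ ν(dx) ∫ p(x,dz) ∫ p(x,dy) ∫ p(x,du) Ê_{z,y}(τ) Ê_{z,u}(τ)`, possibly infinite. -/
noncomputable def couplingConst (p : Kernel E E) (ν : Measure E)
    (Q : Kernel (E × E) (ℕ → E × E)) : ℝ≥0∞ :=
  ∫⁻ x, ∫⁻ z, ∫⁻ y, ∫⁻ u, meanCouplingTime Q z y * meanCouplingTime Q z u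
    ∂(p x) ∂(p x) ∂(p x) ∂ν

end Metric

end CouplingConcentration

/-!
The variance is a sum of second moments of martingale increments, and each increment compares two
futures of the chain, which the given coupling keeps close.

Write `ℱ i` for the past up to time `i`. The increments `V i = E[f | ℱ i] - E[f | ℱ (i - 1)]` are
orthogonal in `L²`, the conditional expectations tend to `f` at `+∞` by Lévy's upward theorem, and
to a constant at `-∞` because the remote past is trivial. Hence `Var f ≤ ∑ i, E (V i)²`
(`evariance_le_tsum_condExp_sub`).

By the Markov property `E[f | ℱ i]` is the integral of `f` over paths that keep the coordinates
before `i` and continue with a fresh chain started at `x i` (`condExp_past_ae_eq`), while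
`E[f | ℱ (i - 1)]` is the same with a fresh chain started from one `p`-step out of `x (i - 1)`
(`resample_sub_one_apply`). No regular conditional distributions are needed, so `E` may be an
arbitrary measurable space here: the law of the one-sided chain, as a kernel in its starting point,
is a marginal of the coupling, and it is unique (`IsMarkovChain.ext_of_map_zero`). Coupling the two
fresh chains, and using that `f` is Lipschitz in each coordinate and insensitive to the coordinates
near `+∞` (`ContinuousAtInfinity.edist_le_tsum`), gives
`|V i| ≤ ∑ j, δ_{i+j}(f) D_j(x (i - 1), x i)`, where `D_j(x, z)` is the mean of `d(u_j, v_j)` when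
`u` starts at `z` and `v` from a `p`-step out of `x` (`enorm_integral_resample_sub_le`).

By stationarity the law of `(x (i - 1), x i)` does not depend on `i`, so the sum over `i` can be
taken inside the expectation, where Young's inequality (`tsum_sq_tsum_mul_le`) bounds it by
`(∑ j, D_j)² ‖δ(f)‖²`. Since `∑ j, D_j(x, z) = ∫ p(x, dy) Ê_{z,y}(τ)`, the expectation of
`(∑ j, D_j)²` is the constant of the theorem. The tail bound is Chebyshev's inequality.
-/

namespace CouplingConcentration

/-! ### Martingale decomposition of the variance -/

section Hilbert

variable {H : Type*} [NormedAddCommGroup H] [InnerProductSpace ℝ H]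

/-- Pythagoras for the projections of a vector onto an increasing sequence of subspaces. -/
lemma starProjection_sub_sq_eq_sum (U : ℕ → Submodule ℝ H) [∀ n, (U n).HasOrthogonalProjection]
    (hU : Monotone U) (v : H) (n : ℕ) :
    ‖(U n).starProjection v - (U 0).starProjection v‖ ^ 2 =
      ∑ k ∈ Finset.range n, ‖(U (k + 1)).starProjection v - (U k).starProjection v‖ ^ 2 := by
  induction n with
  | zero => simp
  | succ n ih =>
    have horth : inner ℝ ((U (n + 1)).starProjection v - (U n).starProjection v)
        ((U n).starProjection v - (U 0).starProjection v) = 0 := by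
      have hw : (U n).starProjection v - (U 0).starProjection v ∈ U n :=
        sub_mem (Submodule.starProjection_apply_mem _ _)
          (hU (Nat.zero_le n) (Submodule.starProjection_apply_mem _ _))
      have h1 := Submodule.starProjection_inner_eq_zero v _ (hU n.le_succ hw)
      have h2 := Submodule.starProjection_inner_eq_zero v _ hw
      have h3 := congrArg₂ (· - ·) h2 h1
      simp only [← inner_sub_left] at h3
      rw [sub_zero] at h3
      rw [← h3]
      congr 1
      abel
    rw [Finset.sum_range_succ, ← ih, add_comm (‖_‖ ^ 2)]
    have := norm_add_sq_eq_norm_sq_add_norm_sq_real horth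
    simp only [sub_add_sub_cancel] at this
    simpa only [sq] using this

/-- The projections of a vector onto a decreasing sequence of closed subspaces converge, and the
limit lies in all of these subspaces. -/
lemma exists_tendsto_starProjection_of_antitone [CompleteSpace H] (U : ℕ → Submodule ℝ H)
    [∀ n, (U n).HasOrthogonalProjection] (hU : Antitone U) (v : H) :
    ∃ b, (∀ n, b ∈ U n) ∧ Tendsto (fun n => (U n).starProjection v) atTop (𝓝 b) := by
  have hmono : Monotone fun n => (U n)ᗮ := fun m n h => Submodule.orthogonal_le (hU h)
  have key := tendsto_const_nhds (x := v) |>.sub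
    (Submodule.starProjection_tendsto_closure_iSup (fun n => (U n)ᗮ) hmono v)
  have hsub : ∀ n, v - (U n)ᗮ.starProjection v = (U n).starProjection v := fun n => by
    rw [sub_eq_iff_eq_add, Submodule.starProjection_add_starProjection_orthogonal]
  simp only [hsub] at key
  refine ⟨_, fun n => ?_, key⟩
  have hclosed : IsClosed (U n : Set H) := by
    rw [← Submodule.orthogonal_orthogonal (U n)]
    exact Submodule.isClosed_orthogonal _
  exact hclosed.mem_of_tendsto key (eventually_atTop.2
    ⟨n, fun k hk => hU hk (Submodule.starProjection_apply_mem _ _)⟩)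

end Hilbert

variable {Ω : Type*} {m0 : MeasurableSpace Ω} {P : Measure Ω}

/-- An almost sure version of membership in the intersection of a decreasing family of
sigma-fields: the limsup of versions measurable for the individual sigma-fields is a version
measurable for the intersection. -/
lemma aestronglyMeasurable_iInf_of_antitone {ℱ : ℕ → MeasurableSpace Ω} (hℱ : Antitone ℱ)
    {g : Ω → ℝ} (hg : ∀ n, AEStronglyMeasurable[ℱ n] g P) :
    AEStronglyMeasurable[iInf ℱ] g P := by
  choose h hm hae using hg
  refine ⟨fun x => limsup (fun n => h n x) atTop, ?_, ?_⟩
  · refine Measurable.stronglyMeasurable (mα := iInf ℱ) ?_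
    intro s hs
    rw [MeasurableSpace.measurableSet_iInf]
    intro k
    have : (fun x => limsup (fun n => h n x) atTop) =
        fun x => limsup (fun n => h (n + k) x) atTop := by
      funext x
      exact (limsup_nat_add (fun n => h n x) k).symm
    rw [this]
    exact (Measurable.limsup (mδ := ℱ k) fun n =>
      ((hm (n + k)).measurable.mono (hℱ (Nat.le_add_left k n)) le_rfl)) hs
  · filter_upwards [ae_all_iff.2 hae] with x hx
    simp [← hx]

/-- A function measurable for a trivial sigma-field is almost surely constant. -/
lemma exists_ae_eq_const_of_trivial [IsProbabilityMeasure P] {m : MeasurableSpace Ω}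
    (hm : m ≤ m0)
    (htriv : ∀ A, MeasurableSet[m] A → P A = 0 ∨ P A = 1) {g : Ω → ℝ}
    (hg : AEStronglyMeasurable[m] g P) : ∃ c : ℝ, g =ᵐ[P] fun _ => c := by
  obtain ⟨h, hh, hgh⟩ := hg
  have : ∃ c, h =ᵐ[P] fun _ => c := by
    refine Filter.exists_eventuallyEq_const_of_forall_separating MeasurableSet fun s hs => ?_
    have hms : MeasurableSet[m] (h ⁻¹' s) := hh.measurable hs
    rcases htriv _ hms with h0 | h1
    · right
      exact measure_eq_zero_iff_ae_notMem.1 h0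
    · left
      exact (mem_ae_iff_prob_eq_one (hm _ hms)).2 h1
  obtain ⟨c, hc⟩ := this
  exact ⟨c, hgh.trans hc⟩

lemma lintegral_enorm_sq_eq_enorm_sq (F : Lp ℝ 2 P) {g : Ω → ℝ} (h : F =ᵐ[P] g) :
    ∫⁻ x, ‖g x‖ₑ ^ 2 ∂P = ‖F‖ₑ ^ 2 := by
  rw [Lp.enorm_def, eLpNorm_congr_ae h]
  have := eLpNorm_nnreal_pow_eq_lintegral (μ := P) (f := g) (p := 2) (by norm_num)
  norm_num at this
  simpa using this.symm

lemma evariance_le_lintegral_enorm_sub_sq [IsProbabilityMeasure P] {f : Ω → ℝ}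
    (hf : MemLp f 2 P) (c : ℝ) : evariance f P ≤ ∫⁻ x, ‖f x - c‖ₑ ^ 2 ∂P := by
  have hfc : MemLp (fun x => f x - c) 2 P := hf.sub (memLp_const c)
  rw [← hf.ofReal_variance_eq, ← variance_sub_const hf.1 c]
  calc ENNReal.ofReal (Var[fun x => f x - c; P])
      ≤ ENNReal.ofReal (∫ x, (f x - c) ^ 2 ∂P) :=
        ENNReal.ofReal_le_ofReal (variance_le_expectation_sq hfc.1)
    _ = ∫⁻ x, ‖f x - c‖ₑ ^ 2 ∂P := by
        rw [ofReal_integral_eq_lintegral_ofReal hfc.integrable_sq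
          (ae_of_all _ fun x => sq_nonneg _)]
        refine lintegral_congr fun x => ?_
        rw [Real.enorm_eq_ofReal_abs, ← ENNReal.ofReal_pow (abs_nonneg _), sq_abs]

/-- **Martingale decomposition of the variance.** For an increasing family of sigma-fields that
exhausts the whole sigma-field at `+∞` and is trivial at `-∞`, the variance is at most the sum of
the second moments of the martingale increments. -/
theorem evariance_le_tsum_condExp_sub [IsProbabilityMeasure P] {ℱ : ℤ → MeasurableSpace Ω}
    (hmono : Monotone ℱ) (hle : ∀ i, ℱ i ≤ m0) (hsup : ⨆ i, ℱ i = m0)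
    (htail : ∀ A, MeasurableSet[⨅ i, ℱ i] A → P A = 0 ∨ P A = 1)
    {f : Ω → ℝ} (hfm : Measurable f) (hf : MemLp f 2 P) :
    evariance f P ≤
      ∑' i : ℤ, ∫⁻ x, ‖(P[f | ℱ i]) x - (P[f | ℱ (i - 1)]) x‖ₑ ^ 2 ∂P := by
  have : ∀ i, Fact (ℱ i ≤ m0) := fun i => ⟨hle i⟩
  set S := ∑' i : ℤ, ∫⁻ x, ‖(P[f | ℱ i]) x - (P[f | ℱ (i - 1)]) x‖ₑ ^ 2 ∂P with hS
  let U : ℤ → Submodule ℝ (Lp ℝ 2 P) := fun i => lpMeas ℝ ℝ (ℱ i) 2 P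
  let a : ℤ → Lp ℝ 2 P := fun i => (U i).starProjection (hf.toLp f)
  have haf : ∀ i, a i =ᵐ[P] P[f | ℱ i] := fun i => hf.condExpL2_ae_eq_condExp (𝕜 := ℝ) (hle i)
  have hUmono : Monotone U := fun i j hij g hg =>
    mem_lpMeas_iff_aestronglyMeasurable.2
      ((mem_lpMeas_iff_aestronglyMeasurable.1 hg).mono (hmono hij))
  have hinc : ∀ i j, ∫⁻ x, ‖(P[f | ℱ i]) x - (P[f | ℱ j]) x‖ₑ ^ 2 ∂P = ‖a i - a j‖ₑ ^ 2 := by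
    intro i j
    refine lintegral_enorm_sq_eq_enorm_sq (a i - a j)
      (g := fun x => (P[f | ℱ i]) x - (P[f | ℱ j]) x) ?_
    filter_upwards [haf i, haf j, Lp.coeFn_sub (a i) (a j)] with x h1 h2 h3
    rw [h3, Pi.sub_apply, h1, h2]
  -- The increments are orthogonal, so their squared norms add up.
  have hpyth : ∀ (m : ℤ) (n : ℕ), ‖a (m + n) - a m‖ₑ ^ 2 ≤ S := by
    intro m n
    have h := starProjection_sub_sq_eq_sum (fun k : ℕ => U (m + k))
      (fun k l hkl => hUmono (by omega)) (hf.toLp f) n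
    have h' : ‖a (m + n) - a m‖ ^ 2 =
        ∑ k ∈ Finset.range n, ‖a (m + (k + 1 : ℕ)) - a (m + k)‖ ^ 2 := by
      simpa [a] using h
    have h'' : ‖a (m + n) - a m‖ₑ ^ 2 =
        ∑ k ∈ Finset.range n, ‖a (m + (k + 1 : ℕ)) - a (m + k)‖ₑ ^ 2 := by
      simp only [← ofReal_norm, ← ENNReal.ofReal_pow (norm_nonneg _)]
      rw [h', ENNReal.ofReal_sum_of_nonneg fun k _ => sq_nonneg _]
    rw [h'', hS]
    have hinj : Function.Injective fun k : ℕ => m + (k + 1 : ℕ) := fun k l hkl => by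
      simpa using hkl
    refine le_trans ?_ (ENNReal.tsum_comp_le_tsum_of_injective hinj _)
    refine le_trans (le_of_eq ?_) (ENNReal.sum_le_tsum (Finset.range n))
    refine Finset.sum_congr rfl fun k _ => ?_
    rw [hinc]
    congr 4
    push_cast
    ring
  -- The conditional expectations converge at `-∞`, to a constant because the tail is trivial.
  have hUanti : Antitone fun n : ℕ => U (-(n : ℤ)) := fun k l hkl => hUmono (by omega)
  obtain ⟨b, hbU, hlim⟩ := exists_tendsto_starProjection_of_antitone
    (fun n : ℕ => U (-(n : ℤ))) hUanti (hf.toLp f)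
  obtain ⟨c, hc⟩ : ∃ c : ℝ, b =ᵐ[P] fun _ => c := by
    have hbm : ∀ n : ℕ, AEStronglyMeasurable[ℱ (-(n : ℤ))] b P := fun n =>
      mem_lpMeas_iff_aestronglyMeasurable.1 (hbU n)
    have hinf : ⨅ n : ℕ, ℱ (-(n : ℤ)) = ⨅ i, ℱ i := by
      refine le_antisymm (le_iInf fun i => ?_) (le_iInf fun n => iInf_le _ _)
      exact (iInf_le _ i.natAbs).trans (hmono (by omega))
    have h := aestronglyMeasurable_iInf_of_antitone (P := P) (ℱ := fun n : ℕ => ℱ (-(n : ℤ)))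
      (fun k l hkl => hmono (by omega)) hbm
    rw [hinf] at h
    exact exists_ae_eq_const_of_trivial ((iInf_le _ 0).trans (hle 0)) htail h
  have hcond : ∀ n : ℕ, ∫⁻ x, ‖(P[f | ℱ n]) x - c‖ₑ ^ 2 ∂P ≤ S := by
    intro n
    have h1 : ∫⁻ x, ‖(P[f | ℱ n]) x - c‖ₑ ^ 2 ∂P = ‖a n - b‖ₑ ^ 2 := by
      refine lintegral_enorm_sq_eq_enorm_sq (a n - b) (g := fun x => (P[f | ℱ n]) x - c) ?_
      filter_upwards [haf n, hc, Lp.coeFn_sub (a n) b] with x h1 h2 h3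
      rw [h3, Pi.sub_apply, h1, h2]
    rw [h1]
    have h2 : Tendsto (fun m : ℕ => ‖a n - a (-(m : ℤ))‖ₑ ^ 2) atTop (𝓝 (‖a n - b‖ₑ ^ 2)) :=
      ((ENNReal.continuous_pow 2).tendsto _).comp (tendsto_const_nhds.sub hlim).enorm
    refine le_of_tendsto h2 (Eventually.of_forall fun m => ?_)
    have := hpyth (-(m : ℤ)) (m + n)
    simpa using this
  -- At `+∞` almost sure convergence is enough, by Fatou.
  let 𝒢 : Filtration ℕ m0 :=
    ⟨fun n => ℱ n, fun k l hkl => hmono (by exact_mod_cast hkl), fun n => hle n⟩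
  have hsup' : ⨆ n, 𝒢 n = m0 := by
    refine Eq.trans ?_ hsup
    refine le_antisymm (iSup_le fun n => le_iSup ℱ n) (iSup_le fun i => ?_)
    exact (hmono (show i ≤ (i.natAbs : ℤ) by omega)).trans (le_iSup (fun n => 𝒢 n) i.natAbs)
  have hae : ∀ᵐ x ∂P, Tendsto (fun n : ℕ => (P[f | ℱ n]) x) atTop (𝓝 (f x)) := by
    refine (hf.integrable one_le_two).tendsto_ae_condExp (ℱ := 𝒢) ?_
    rw [hsup']
    exact hfm.stronglyMeasurable
  calc evariance f P ≤ ∫⁻ x, ‖f x - c‖ₑ ^ 2 ∂P := evariance_le_lintegral_enorm_sub_sq hf c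
    _ = ∫⁻ x, liminf (fun n : ℕ => ‖(P[f | ℱ n]) x - c‖ₑ ^ 2) atTop ∂P := by
        refine lintegral_congr_ae ?_
        filter_upwards [hae] with x hx
        exact (((ENNReal.continuous_pow 2).tendsto _).comp
          (hx.sub tendsto_const_nhds).enorm).liminf_eq.symm
    _ ≤ liminf (fun n : ℕ => ∫⁻ x, ‖(P[f | ℱ n]) x - c‖ₑ ^ 2 ∂P) atTop :=
        lintegral_liminf_le fun n =>
          (((stronglyMeasurable_condExp.mono (hle _)).measurable.sub_const c).enorm.pow_const 2)
    _ ≤ S := liminf_le_of_le (by isBoundedDefault) fun d hd => by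
        obtain ⟨n, hn⟩ := hd.exists
        exact hn.trans (hcond n)

/-! ### The past of the path space -/

section Past

variable {S ι : Type*} [MeasurableSpace S]

lemma past_mono [Preorder ι] : Monotone (past : ι → MeasurableSpace (ι → S)) := fun _ _ hij =>
  iSup_mono fun _ => iSup_mono' fun hk => ⟨hk.trans hij, le_rfl⟩

lemma past_le [Preorder ι] (i : ι) : past i ≤ (MeasurableSpace.pi : MeasurableSpace (ι → S)) :=
  iSup₂_le fun k _ => (measurable_pi_apply k).comap_le

lemma measurable_apply_past [Preorder ι] {i k : ι} (hk : k ≤ i) :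
    Measurable[past i] fun x : ι → S => x k := by
  rw [measurable_iff_comap_le]
  exact le_iSup₂_of_le k hk le_rfl

lemma iSup_past [Preorder ι] : ⨆ i : ι, past i = (MeasurableSpace.pi : MeasurableSpace (ι → S)) :=
  le_antisymm (iSup_le past_le)
    (iSup_le fun i => le_iSup_of_le i (le_iSup₂_of_le (f := fun k (_ : k ≤ i) =>
      MeasurableSpace.comap (fun x : ι → S => x k) inferInstance) i le_rfl le_rfl))

/-- The path stopped at time `i`. It carries exactly the information of the past up to `i`. -/
def stopAt [LinearOrder ι] (i : ι) (x : ι → S) : ι → S := fun k => x (min k i)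

/-- `measurable_pi_iff` for a sigma-field on the domain that is not the canonical one. -/
lemma measurable_of_forall_apply {Ω : Type*} (m : MeasurableSpace Ω) {g : Ω → ι → S}
    (h : ∀ k, Measurable fun ω => g ω k) : Measurable g :=
  measurable_pi_iff.2 h

lemma measurable_stopAt [LinearOrder ι] (i : ι) :
    Measurable[past i, MeasurableSpace.pi] (stopAt i : (ι → S) → ι → S) :=
  measurable_of_forall_apply (past i) fun _ => measurable_apply_past (min_le_right _ _)

lemma past_eq_comap_stopAt [LinearOrder ι] (i : ι) :
    (past i : MeasurableSpace (ι → S)) = MeasurableSpace.comap (stopAt i) MeasurableSpace.pi := by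
  refine le_antisymm (iSup₂_le fun k hk => ?_) (measurable_stopAt i).comap_le
  have : (fun x : ι → S => x k) = (fun x => x k) ∘ stopAt i := by
    funext x
    simp [stopAt, hk]
  rw [this, ← MeasurableSpace.comap_comp]
  exact MeasurableSpace.comap_mono (measurable_pi_apply k).comap_le

/-- Membership in an event of the past up to `i` depends on the coordinates up to `i` only. -/
lemma mem_iff_of_measurableSet_past [LinearOrder ι] {i : ι} {A : Set (ι → S)}
    (hA : MeasurableSet[past i] A) {x y : ι → S} (h : ∀ k ≤ i, x k = y k) : x ∈ A ↔ y ∈ A := by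
  rw [past_eq_comap_stopAt] at hA
  obtain ⟨B, -, rfl⟩ := hA
  have : stopAt i x = stopAt i y := funext fun k => h _ (min_le_right _ _)
  simp [this]

end Past

/-- Two finite measures that agree on the intersections of the events of two sigma-fields agree on
the sigma-field generated by both. -/
lemma measure_eq_of_forall_inter {Ω : Type*} {m₁ m₂ m0 : MeasurableSpace Ω} {μ μ' : Measure Ω}
    [IsFiniteMeasure μ] (h₁ : m₁ ≤ m0) (h₂ : m₂ ≤ m0)
    (h : ∀ A, MeasurableSet[m₁] A → ∀ B, MeasurableSet[m₂] B → μ (A ∩ B) = μ' (A ∩ B))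
    {s : Set Ω} (hs : MeasurableSet[m₁ ⊔ m₂] s) : μ s = μ' s := by
  let C : Set (Set Ω) := {t | ∃ A, MeasurableSet[m₁] A ∧ ∃ B, MeasurableSet[m₂] B ∧ A ∩ B = t}
  have hC : IsPiSystem C := by
    rintro _ ⟨A, hA, B, hB, rfl⟩ _ ⟨A', hA', B', hB', rfl⟩ -
    exact ⟨A ∩ A', hA.inter hA', B ∩ B', hB.inter hB', Set.inter_inter_inter_comm _ _ _ _⟩
  have hgen : m₁ ⊔ m₂ = MeasurableSpace.generateFrom C := by
    refine le_antisymm (sup_le (fun A hA => ?_) fun B hB => ?_)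
      (MeasurableSpace.generateFrom_le ?_)
    · exact MeasurableSpace.measurableSet_generateFrom
        ⟨A, hA, Set.univ, MeasurableSet.univ, Set.inter_univ A⟩
    · exact MeasurableSpace.measurableSet_generateFrom
        ⟨Set.univ, MeasurableSet.univ, B, hB, Set.univ_inter B⟩
    · rintro _ ⟨A, hA, B, hB, rfl⟩
      exact MeasurableSet.inter (le_sup_left (a := m₁) (b := m₂) _ hA)
        (le_sup_right (a := m₁) (b := m₂) _ hB)
  have huniv : μ Set.univ = μ' Set.univ := by
    simpa using h Set.univ MeasurableSet.univ Set.univ MeasurableSet.univ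
  have hle : m₁ ⊔ m₂ ≤ m0 := sup_le h₁ h₂
  have : μ.trim hle = μ'.trim hle := by
    refine ext_of_generate_finite C hgen hC (fun t ht => ?_) ?_
    · have htm : MeasurableSet[m₁ ⊔ m₂] t := hgen ▸ MeasurableSpace.measurableSet_generateFrom ht
      obtain ⟨A, hA, B, hB, rfl⟩ := ht
      rw [trim_measurableSet_eq hle htm, trim_measurableSet_eq hle htm, h A hA B hB]
    · rw [trim_measurableSet_eq hle MeasurableSet.univ, trim_measurableSet_eq hle MeasurableSet.univ,
        huniv]
  rw [← trim_measurableSet_eq hle hs, this, trim_measurableSet_eq hle hs]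

/-! ### Chains on one-sided paths -/

section OneSided

variable {S : Type*} [MeasurableSpace S] {κ : Kernel S S}

/-- A finite measure on one-sided paths that is Markov with a given kernel is determined by its
initial distribution. -/
theorem IsMarkovChain.ext_of_map_zero {Q₁ Q₂ : Measure (ℕ → S)} [IsFiniteMeasure Q₁]
    (h₁ : IsMarkovChain κ Q₁) (h₂ : IsMarkovChain κ Q₂)
    (h0 : Q₁.map (fun x => x 0) = Q₂.map (fun x => x 0)) : Q₁ = Q₂ := by
  have key : ∀ n : ℕ, ∀ A, MeasurableSet[past n] A → Q₁ A = Q₂ A := by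
    intro n
    induction n with
    | zero =>
      intro A hA
      have hpast : (past 0 : MeasurableSpace (ℕ → S)) =
          MeasurableSpace.comap (fun x => x 0) inferInstance := by
        simp [past]
      rw [hpast] at hA
      obtain ⟨B, hB, rfl⟩ := hA
      rw [← Measure.map_apply (measurable_pi_apply 0) hB, h0,
        Measure.map_apply (measurable_pi_apply 0) hB]
    | succ n ih =>
      intro A hA
      have hsucc : (past (n + 1) : MeasurableSpace (ℕ → S)) ≤
          past n ⊔ MeasurableSpace.comap (fun x => x (n + 1)) inferInstance := by
        refine iSup₂_le fun k hk => ?_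
        rcases Nat.lt_or_eq_of_le hk with h | rfl
        · exact le_sup_of_le_left (le_iSup₂_of_le k (Nat.lt_succ_iff.1 h) le_rfl)
        · exact le_sup_right
      have htrim : Q₁.trim (past_le n) = Q₂.trim (past_le n) := by
        refine @Measure.ext _ (past n) _ _ fun s hs => ?_
        rw [trim_measurableSet_eq _ hs, trim_measurableSet_eq _ hs, ih s hs]
      refine measure_eq_of_forall_inter (μ := Q₁) (past_le n) (measurable_pi_apply (n + 1)).comap_le ?_
        (hsucc A hA)
      rintro A hA _ ⟨B, hB, rfl⟩
      have hg : Measurable[past n] fun x : ℕ → S => κ (x n) B :=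
        (κ.measurable_coe hB).comp (measurable_apply_past le_rfl)
      rw [show (fun x : ℕ → S => x (n + 1)) ⁻¹' B = {x | x (n + 1) ∈ B} from rfl, h₁ n A hA B hB,
        h₂ n A hA B hB, ← lintegral_indicator (past_le n _ hA),
        ← lintegral_indicator (past_le n _ hA), ← lintegral_trim (past_le n) (hg.indicator hA),
        htrim, lintegral_trim (past_le n) (hg.indicator hA)]
  have hpi : IsPiSystem (⋃ n : ℕ, {A : Set (ℕ → S) | MeasurableSet[past n] A}) :=
    isPiSystem_iUnion_of_monotone _ (fun n => (past n).isPiSystem_measurableSet)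
      fun m n hmn => past_mono hmn
  refine ext_of_generate_finite _ ?_ hpi ?_ (key 0 _ MeasurableSet.univ)
  · exact iSup_past.symm.trans (MeasurableSpace.generateFrom_iUnion_measurableSet _).symm
  · rintro A hA
    obtain ⟨n, hn⟩ := Set.mem_iUnion.1 hA
    exact key n A hn

lemma measurable_shift : Measurable fun (x : ℕ → S) n => x (n + 1) :=
  measurable_pi_iff.2 fun _ => measurable_pi_apply _

/-- Forgetting the initial segment of a Markov chain on an event that is observed by time `i`
leaves a Markov chain. -/
lemma IsMarkovChain.map_shift_restrict_int {P : Measure (ℤ → S)} (hP : IsMarkovChain κ P) {i : ℤ}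
    {A : Set (ℤ → S)} (hA : MeasurableSet[past i] A) :
    IsMarkovChain κ ((P.restrict A).map fun x (n : ℕ) => x (i + n)) := by
  have hθ : Measurable fun (x : ℤ → S) (n : ℕ) => x (i + n) :=
    measurable_pi_iff.2 fun _ => measurable_pi_apply _
  intro n A' hA' B hB
  have hA'' : MeasurableSet[past (i + n)] ((fun (x : ℤ → S) (n : ℕ) => x (i + n)) ⁻¹' A') := by
    rw [past_eq_comap_stopAt] at hA'
    obtain ⟨C, hC, rfl⟩ := hA'
    refine measurable_of_forall_apply (past (i + n))
      (g := fun (x : ℤ → S) => stopAt n fun (n : ℕ) => x (i + n)) (fun k => ?_) hC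
    exact measurable_apply_past (by simp)
  have hm := past_le _ _ hA''
  have hBm : MeasurableSet {x : ℕ → S | x (n + 1) ∈ B} := measurable_pi_apply (n + 1) hB
  have hmk := hP (i + n) _ ((past_mono (by omega) _ hA).inter hA'') B hB
  rw [Measure.map_apply hθ ((past_le _ _ hA').inter hBm),
    Measure.restrict_apply (hθ ((past_le _ _ hA').inter hBm)),
    setLIntegral_map (f := fun x : ℕ → S => κ (x n) B) (past_le _ _ hA')
      ((κ.measurable_coe hB).comp (measurable_pi_apply n)) hθ, Measure.restrict_restrict hm]
  rw [Set.inter_comm A] at hmk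
  rw [← hmk]
  congr 1
  ext x
  simp only [Set.mem_inter_iff, Set.mem_preimage, Set.mem_ofPred_eq, Nat.cast_add, Nat.cast_one,
    add_assoc]
  tauto

lemma IsMarkovChain.map_shift {Q : Measure (ℕ → S)} (hQ : IsMarkovChain κ Q) :
    IsMarkovChain κ (Q.map fun x n => x (n + 1)) := by
  intro n A hA B hB
  have hA' : MeasurableSet[past (n + 1)] ((fun (x : ℕ → S) n => x (n + 1)) ⁻¹' A) := by
    rw [past_eq_comap_stopAt] at hA
    obtain ⟨C, hC, rfl⟩ := hA
    refine measurable_of_forall_apply (past (n + 1))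
      (g := fun (x : ℕ → S) => stopAt n fun n => x (n + 1)) (fun k => ?_) hC
    exact measurable_apply_past (by simp)
  have hBm : MeasurableSet {x : ℕ → S | x (n + 1) ∈ B} := measurable_pi_apply (n + 1) hB
  rw [Measure.map_apply measurable_shift ((past_le _ _ hA).inter hBm),
    setLIntegral_map (f := fun x : ℕ → S => κ (x n) B) (past_le _ _ hA)
      ((κ.measurable_coe hB).comp (measurable_pi_apply n)) measurable_shift]
  exact hQ (n + 1) _ hA' B hB

variable {K : Kernel S (ℕ → S)}

/-- A mixture of laws of Markov chains with kernel `κ` is Markov with kernel `κ`. -/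
lemma isMarkovChain_comp (hK : ∀ s, IsMarkovChain κ (K s)) (μ : Measure S) :
    IsMarkovChain κ (K ∘ₘ μ) := by
  intro n A hA B hB
  have hAm := past_le _ _ hA
  have hBm : MeasurableSet {x : ℕ → S | x (n + 1) ∈ B} := measurable_pi_apply (n + 1) hB
  have hg : Measurable fun x : ℕ → S => κ (x n) B :=
    (κ.measurable_coe hB).comp (measurable_pi_apply n)
  rw [Measure.bind_apply (hAm.inter hBm) K.aemeasurable, ← lintegral_indicator hAm,
    Measure.lintegral_bind K.aemeasurable (hg.indicator hAm).aemeasurable]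
  refine lintegral_congr fun s => ?_
  rw [lintegral_indicator hAm, hK s n A hA B hB]

lemma IsMarkovChainFrom.isProbabilityMeasure {s : S} {Q : Measure (ℕ → S)}
    (h : IsMarkovChainFrom κ s Q) : IsProbabilityMeasure Q := by
  refine ⟨?_⟩
  have := congrArg (fun m => m Set.univ) h.start
  simpa [Measure.map_apply (measurable_pi_apply (0 : ℕ)) MeasurableSet.univ] using this

lemma IsMarkovChainFrom.unique {s : S} {Q₁ Q₂ : Measure (ℕ → S)}
    (h₁ : IsMarkovChainFrom κ s Q₁) (h₂ : IsMarkovChainFrom κ s Q₂) : Q₁ = Q₂ :=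
  have := h₁.isProbabilityMeasure
  h₁.markov.ext_of_map_zero h₂.markov (h₁.start.trans h₂.start.symm)

lemma map_zero_comp (hK : ∀ s, IsMarkovChainFrom κ s (K s)) (μ : Measure S) :
    (K ∘ₘ μ).map (fun x => x 0) = μ := by
  have : K.map (fun x => x 0) = Kernel.id := by
    ext1 s
    rw [Kernel.map_apply _ (measurable_pi_apply 0), (hK s).start, Kernel.id_apply]
  rw [Measure.map_comp _ _ (measurable_pi_apply 0), this, Measure.id_comp]

/-- After its first step, the chain started at `s` is the chain started from the distribution
`κ s`. -/
lemma map_shift_eq_comp (hK : ∀ s, IsMarkovChainFrom κ s (K s)) (s : S) :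
    (K s).map (fun x n => x (n + 1)) = K ∘ₘ κ s := by
  have := (hK s).isProbabilityMeasure
  refine (hK s).markov.map_shift.ext_of_map_zero (isMarkovChain_comp (fun s => (hK s).markov) _) ?_
  rw [map_zero_comp hK, Measure.map_map (measurable_pi_apply 0) measurable_shift]
  ext B hB
  rw [Measure.map_apply (by fun_prop) hB]
  have h := (hK s).markov 0 Set.univ MeasurableSet.univ B hB
  rw [Set.univ_inter, Measure.restrict_univ,
    ← lintegral_map (f := fun a => κ a B) (κ.measurable_coe hB) (measurable_pi_apply 0),
    (hK s).start, lintegral_dirac' _ (κ.measurable_coe hB)] at h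
  exact h

end OneSided

/-! ### Resampling the future of a two-sided chain -/

section TwoSided

variable {S : Type*}

/-- The two-sided path that follows `x` before time `i` and the one-sided path `u` from time `i`
on. -/
def glue (i : ℤ) (x : ℤ → S) (u : ℕ → S) : ℤ → S :=
  fun k => if k < i then x k else u (k - i).toNat

lemma glue_of_lt {i k : ℤ} (h : k < i) (x : ℤ → S) (u : ℕ → S) : glue i x u k = x k := if_pos h

lemma glue_add (i : ℤ) (x : ℤ → S) (u : ℕ → S) (n : ℕ) : glue i x u (i + n) = u n := by
  simp [glue]

variable [MeasurableSpace S]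

lemma measurable_glue (i : ℤ) : Measurable fun q : (ℤ → S) × (ℕ → S) => glue i q.1 q.2 := by
  refine measurable_pi_iff.2 fun k => ?_
  unfold glue
  by_cases h : k < i
  · simp only [h, if_true]; fun_prop
  · simp only [h, if_false]; fun_prop

lemma measurable_glue_right (i : ℤ) (x : ℤ → S) : Measurable (glue i x) :=
  (measurable_glue i).comp measurable_prodMk_left

/-- Resampling from time `i` on: given the path `x`, keep the coordinates before `i` and
let a fresh path with law `K (x i)` follow from time `i`. -/
noncomputable def resample (K : Kernel S (ℕ → S)) (i : ℤ) : Kernel (ℤ → S) (ℤ → S) :=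
  (Kernel.id ×ₖ K.comap (fun x : ℤ → S => x i) (measurable_pi_apply i)).map
    fun q => glue i q.1 q.2

variable {κ : Kernel S S} {K : Kernel S (ℕ → S)}

lemma resample_apply [IsMarkovKernel K] (i : ℤ) (x : ℤ → S) :
    resample K i x = (K (x i)).map (glue i x) := by
  rw [resample, Kernel.map_apply _ (measurable_glue i), Kernel.prod_apply, Kernel.id_apply,
    Kernel.comap_apply, Measure.dirac_prod, Measure.map_map (measurable_glue i) (by fun_prop)]
  rfl

instance [IsMarkovKernel K] (i : ℤ) : IsMarkovKernel (resample K i) :=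
  Kernel.IsMarkovKernel.map _ (measurable_glue i)

lemma resample_stopAt [IsMarkovKernel K] (i : ℤ) (x : ℤ → S) :
    resample K i (stopAt i x) = resample K i x := by
  rw [resample_apply, resample_apply]
  have h : glue i (stopAt i x) = glue i x := by
    funext u k
    unfold glue stopAt
    split_ifs with hk
    · rw [min_eq_left hk.le]
    · rfl
  simp [h, stopAt]

/-- The Markov property: the future from time `i` on, restricted to an event of the past, is the
chain started from the restricted law of the present. -/
lemma map_future_restrict (hK : ∀ s, IsMarkovChainFrom κ s (K s)) {P : Measure (ℤ → S)}
    [IsFiniteMeasure P] (hP : IsMarkovChain κ P) {i : ℤ} {A : Set (ℤ → S)}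
    (hA : MeasurableSet[past i] A) :
    (P.restrict A).map (fun x (n : ℕ) => x (i + n)) = K ∘ₘ (P.restrict A).map (fun x => x i) := by
  have hθ : Measurable fun (x : ℤ → S) (n : ℕ) => x (i + n) :=
    measurable_pi_iff.2 fun _ => measurable_pi_apply _
  refine (hP.map_shift_restrict_int hA).ext_of_map_zero
    (isMarkovChain_comp (fun s => (hK s).markov) _) ?_
  rw [map_zero_comp hK, Measure.map_map (measurable_pi_apply 0) hθ]
  simp [Function.comp_def]

/-- Resampling the future does not change the law of a Markov chain on events of the past. -/
lemma resample_comp_restrict [IsMarkovKernel K] (hK : ∀ s, IsMarkovChainFrom κ s (K s))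
    {P : Measure (ℤ → S)} [IsFiniteMeasure P] (hP : IsMarkovChain κ P) {i : ℤ}
    {A : Set (ℤ → S)} (hA : MeasurableSet[past i] A) :
    resample K i ∘ₘ P.restrict A = P.restrict A := by
  have hθ : Measurable fun (x : ℤ → S) (n : ℕ) => x (i + n) :=
    measurable_pi_iff.2 fun _ => measurable_pi_apply _
  -- The strict past and the future from time `i` on generate everything. With the past up to `i`
  -- instead, resampling would preserve events of the past only almost surely.
  have hgen : (MeasurableSpace.pi : MeasurableSpace (ℤ → S)) ≤
      past (i - 1) ⊔ MeasurableSpace.comap (fun x (n : ℕ) => x (i + n)) MeasurableSpace.pi := by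
    refine iSup_le fun k => ?_
    rcases lt_or_ge k i with h | h
    · exact le_sup_of_le_left (le_iSup₂_of_le k (by omega) le_rfl)
    · refine le_sup_of_le_right ?_
      have : (fun x : ℤ → S => x k) =
          (fun u : ℕ → S => u (k - i).toNat) ∘ fun x (n : ℕ) => x (i + n) := by
        funext x
        simp only [Function.comp_apply]
        congr 1
        omega
      rw [this, ← MeasurableSpace.comap_comp]
      exact MeasurableSpace.comap_mono (measurable_pi_apply _).comap_le
  ext s hs
  refine measure_eq_of_forall_inter (μ := resample K i ∘ₘ P.restrict A) (past_le (i - 1)) hθ.comap_le ?_ (hgen s hs)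
  rintro A' hA' _ ⟨B, hB, rfl⟩
  have hA'm := past_le _ _ hA'
  have hAA' : MeasurableSet[past i] (A' ∩ A) := (past_mono (by omega) _ hA').inter hA
  have hpre : ∀ x : ℤ → S, resample K i x (A' ∩ (fun x (n : ℕ) => x (i + n)) ⁻¹' B) =
      A'.indicator (fun x => K (x i) B) x := by
    intro x
    rw [resample_apply, Measure.map_apply (measurable_glue_right i x) (hA'm.inter (hθ hB))]
    have h1 : ∀ u, glue i x u ∈ A' ↔ x ∈ A' := fun u =>
      mem_iff_of_measurableSet_past hA' fun k hk =>
        glue_of_lt (by omega) x u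
    have h2 : ∀ u, (fun n : ℕ => glue i x u (i + n)) = u := fun u =>
      funext (glue_add i x u)
    by_cases hx : x ∈ A'
    · rw [Set.indicator_of_mem hx]
      congr 1
      ext u
      simp [h1, h2, hx]
    · rw [Set.indicator_of_notMem hx]
      convert measure_empty (μ := K (x i))
      ext u
      simp [h1, hx]
  rw [Measure.bind_apply (hA'm.inter (hθ hB)) (resample K i).aemeasurable, lintegral_congr hpre,
    lintegral_indicator hA'm, Measure.restrict_restrict hA'm,
    Measure.restrict_apply (hA'm.inter (hθ hB))]
  have key := congrArg (fun m => m B) (map_future_restrict hK hP hAA')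
  rw [Measure.map_apply hθ hB, Measure.restrict_apply (hθ hB),
    Measure.bind_apply hB K.aemeasurable,
    lintegral_map (K.measurable_coe hB) (measurable_pi_apply i)] at key
  rw [← key]
  congr 1
  ext x
  simp only [Set.mem_inter_iff]
  tauto

lemma stronglyMeasurable_past_integral_resample [IsMarkovKernel K] (i : ℤ)
    {f : (ℤ → S) → ℝ} (hfm : Measurable f) :
    StronglyMeasurable[past i] fun x => ∫ y, f y ∂(resample K i x) := by
  have h : (fun x => ∫ y, f y ∂(resample K i x)) =
      (fun x => ∫ y, f y ∂(resample K i x)) ∘ stopAt i := by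
    funext x
    simp only [Function.comp_apply, resample_stopAt]
  have h' : StronglyMeasurable fun x => ∫ y, f y ∂(resample K i x) :=
    hfm.stronglyMeasurable.integral_kernel
  rw [h]
  exact h'.comp_measurable (measurable_stopAt i)

/-- The conditional expectation given the past up to `i` is the expectation after resampling. -/
theorem condExp_past_ae_eq [IsMarkovKernel K] (hK : ∀ s, IsMarkovChainFrom κ s (K s))
    {P : Measure (ℤ → S)} [IsFiniteMeasure P] (hP : IsMarkovChain κ P) (i : ℤ)
    {f : (ℤ → S) → ℝ} (hfm : Measurable f) (hf : Integrable f P) :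
    P[f | past i] =ᵐ[P] fun x => ∫ y, f y ∂(resample K i x) := by
  have hcomp : resample K i ∘ₘ P = P := by
    have h := resample_comp_restrict hK hP (A := Set.univ) (i := i) MeasurableSet.univ
    rwa [Measure.restrict_univ] at h
  have hf' : Integrable f (resample K i ∘ₘ P) := by rwa [hcomp]
  have hint : Integrable (fun x => ∫ y, f y ∂(resample K i x)) P := by
    rw [Measure.comp_eq_comp_const_apply] at hf'
    simpa only [Kernel.const_apply] using hf'.integral_comp
  refine (ae_eq_condExp_of_forall_setIntegral_eq (past_le i) hf
    (fun s _ _ => hint.integrableOn) (fun s hs _ => ?_) ?_).symm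
  · have h := resample_comp_restrict hK hP hs
    have hfs : Integrable f (resample K i ∘ₘ P.restrict s) := by
      rw [h]
      exact hf.restrict
    have hi : ∫ y, f y ∂(resample K i ∘ₘ P.restrict s) =
        ∫ x in s, ∫ y, f y ∂(resample K i x) ∂P := by
      rw [Measure.comp_eq_comp_const_apply] at hfs ⊢
      simpa only [Kernel.const_apply] using Kernel.integral_comp hfs
    rw [← hi, h]
  · exact (stronglyMeasurable_past_integral_resample i hfm).aestronglyMeasurable

/-- Resampling from time `i - 1` on is the same as moving one step with `κ` and continuing from
time `i` on. -/
lemma resample_sub_one_apply [MeasurableSingletonClass S] [IsMarkovKernel K]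
    (hK : ∀ s, IsMarkovChainFrom κ s (K s)) (i : ℤ) (x : ℤ → S) :
    resample K (i - 1) x = (K ∘ₘ κ (x (i - 1))).map (glue i x) := by
  rw [resample_apply, ← map_shift_eq_comp hK,
    Measure.map_map (measurable_glue_right i x) measurable_shift]
  refine Measure.map_congr ?_
  -- Gluing at `i - 1` puts `u 0` at time `i - 1`, gluing the shifted path at `i` keeps `x (i - 1)`.
  have h0 : ∀ᵐ u ∂(K (x (i - 1))), u 0 = x (i - 1) := by
    refine ae_of_ae_map (f := fun u : ℕ → S => u 0) (p := fun s => s = x (i - 1))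
      (measurable_pi_apply 0).aemeasurable ?_
    rw [(hK _).start, ae_dirac_eq]
    rfl
  filter_upwards [h0] with u hu
  funext k
  simp only [glue, Function.comp_apply]
  rcases lt_trichotomy k (i - 1) with h | rfl | h
  · rw [if_pos h, if_pos (by omega)]
  · simp [hu]
  · rw [if_neg (by omega), if_neg (by omega)]
    congr 1
    omega

end TwoSided

/-! ### A convolution inequality -/

section Convolution

lemma two_mul_mul_le_sq_add_sq (a b : ℝ≥0∞) : 2 * (a * b) ≤ a ^ 2 + b ^ 2 := by
  rcases eq_or_ne a ∞ with rfl | ha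
  · simp
  rcases eq_or_ne b ∞ with rfl | hb
  · simp
  lift a to NNReal using ha
  lift b to NNReal using hb
  have := two_mul_le_add_sq a b
  rw [mul_assoc] at this
  exact_mod_cast this

/-- Young's inequality for the correlation of a square summable with a summable sequence. -/
lemma tsum_sq_tsum_mul_le (a : ℤ → ℝ≥0∞) (b : ℕ → ℝ≥0∞) :
    ∑' i : ℤ, (∑' j : ℕ, a (i + j) * b j) ^ 2 ≤ (∑' j, b j) ^ 2 * ∑' i, a i ^ 2 := by
  have hshift : ∀ j : ℕ, ∑' i : ℤ, a (i + j) ^ 2 = ∑' i, a i ^ 2 := fun j =>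
    (Equiv.addRight (j : ℤ)).tsum_eq fun i => a i ^ 2
  have hcorr : ∀ j k : ℕ, ∑' i : ℤ, a (i + j) * a (i + k) ≤ ∑' i, a i ^ 2 := by
    intro j k
    have h2 : 2 * ∑' i : ℤ, a (i + j) * a (i + k) ≤ 2 * ∑' i, a i ^ 2 := by
      calc 2 * ∑' i : ℤ, a (i + j) * a (i + k)
          ≤ ∑' i : ℤ, (a (i + j) ^ 2 + a (i + k) ^ 2) := by
            rw [← ENNReal.tsum_mul_left]
            exact ENNReal.tsum_le_tsum fun i => two_mul_mul_le_sq_add_sq _ _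
        _ = 2 * ∑' i, a i ^ 2 := by
            rw [ENNReal.tsum_add, hshift, hshift, two_mul]
    exact (ENNReal.mul_le_mul_iff_right two_ne_zero ENNReal.ofNat_ne_top).1 h2
  calc ∑' i : ℤ, (∑' j : ℕ, a (i + j) * b j) ^ 2
      = ∑' i : ℤ, ∑' j : ℕ, ∑' k : ℕ, b j * b k * (a (i + j) * a (i + k)) := by
        refine tsum_congr fun i => ?_
        rw [sq, ← ENNReal.tsum_mul_right]
        refine tsum_congr fun j => ?_
        rw [← ENNReal.tsum_mul_left]
        exact tsum_congr fun k => by ring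
    _ = ∑' j : ℕ, ∑' k : ℕ, b j * b k * ∑' i : ℤ, a (i + j) * a (i + k) := by
        rw [ENNReal.tsum_comm]
        refine tsum_congr fun j => ?_
        rw [ENNReal.tsum_comm]
        exact tsum_congr fun k => ENNReal.tsum_mul_left
    _ ≤ ∑' j : ℕ, ∑' k : ℕ, b j * b k * ∑' i, a i ^ 2 :=
        ENNReal.tsum_le_tsum fun j => ENNReal.tsum_le_tsum fun k => mul_le_mul_right (hcorr j k) _
    _ = (∑' j, b j) ^ 2 * ∑' i, a i ^ 2 := by
        simp_rw [ENNReal.tsum_mul_right, ENNReal.tsum_mul_left]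
        rw [ENNReal.tsum_mul_right, sq]

end Convolution

/-! ### Functions with coordinatewise Lipschitz constants -/

section Lipschitz

variable {E : Type*} [MetricSpace E] {f : (ℤ → E) → ℝ}

lemma edist_le_lipConst_mul {x y : ℤ → E} {i : ℤ} (h : ∀ j, j ≠ i → x j = y j) :
    edist (f x) (f y) ≤ lipConst f i * edist (x i) (y i) := by
  rcases eq_or_ne (x i) (y i) with hi | hi
  · have : x = y := funext fun j => by
      by_cases hj : j = i
      · rw [hj, hi]
      · exact h j hj
    simp [this]
  · rw [← ENNReal.div_le_iff (edist_pos.2 hi).ne' (edist_ne_top _ _)]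
    exact le_iSup₂_of_le x y (le_iSup₂_of_le h hi le_rfl)

/-- If `x` and `y` agree before time `i`, then `|f x - f y|` is at most the weighted distance of
`x` and `y` from time `i` on. Changing the coordinates one at a time gives this for finitely many
differing coordinates, and insensitivity at `+∞` gives it in general. -/
lemma ContinuousAtInfinity.edist_le_tsum (hf : ContinuousAtInfinity f) {x y : ℤ → E} {i : ℤ}
    (h : ∀ k < i, x k = y k) :
    edist (f x) (f y) ≤ ∑' j : ℕ, lipConst f (i + j) * edist (x (i + j)) (y (i + j)) := by
  set T := ∑' j : ℕ, lipConst f (i + j) * edist (x (i + j)) (y (i + j))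
  rcases eq_or_ne T ∞ with htop | htop
  · simp [htop]
  let w : ℕ → ℤ → E := fun N k => if k < i + N then x k else y k
  have hw : ∀ N, edist (f (w N)) (f y) ≤
      ∑ j ∈ Finset.range N, lipConst f (i + j) * edist (x (i + j)) (y (i + j)) := by
    intro N
    induction N with
    | zero =>
      have : w 0 = y := by
        funext k
        by_cases hk : k < i <;> simp [w, hk, h]
      simp [this]
    | succ N ih =>
      have hstep := edist_le_lipConst_mul (f := f) (x := w (N + 1)) (y := w N) (i := i + N)
        fun j hj => by
          have : (j < i + (N + 1 : ℕ)) ↔ (j < i + N) := by omega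
          simp only [w, this]
      have h1 : w (N + 1) (i + N) = x (i + N) := by simp [w]
      have h2 : w N (i + N) = y (i + N) := by simp [w]
      rw [h1, h2] at hstep
      rw [Finset.sum_range_succ]
      exact (edist_triangle _ (f (w N)) _).trans
        ((add_le_add hstep ih).trans_eq (add_comm _ _))
  have hsum : ∑' k : ℤ, lipConst f k * edist (x k) (y k) = T := by
    have hinj : Function.Injective fun j : ℕ => i + (j : ℤ) := fun a b hab => by simpa using hab
    refine (hinj.tsum_eq (f := fun k => lipConst f k * edist (x k) (y k)) ?_).symm
    intro k hk
    by_contra hk'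
    refine hk ?_
    have hki : k < i := by
      by_contra hlt
      exact hk' ⟨(k - i).toNat, by simp only; omega⟩
    simp [h k hki]
  have hlim := hf x y (by rw [hsum]; exact htop.lt_top)
  refine le_of_tendsto (hlim.edist tendsto_const_nhds) (eventually_atTop.2 ⟨i.toNat, fun n hn => ?_⟩)
  have hz : (fun k => if k ≤ (n : ℤ) then x k else y k) = w ((n : ℤ) + 1 - i).toNat := by
    funext k
    have : k ≤ (n : ℤ) ↔ k < i + (((n : ℤ) + 1 - i).toNat : ℕ) := by omega
    simp only [w, this]
  rw [hz]
  exact (hw _).trans (ENNReal.sum_le_tsum _)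

end Lipschitz

/-! ### Two consecutive states of the stationary chain -/

section Chain

variable {S : Type*} [MeasurableSpace S] {p : Kernel S S} {ν : Measure S} {P : Measure (ℤ → S)}

lemma IsStationaryMarkovChain.map_apply (hP : IsStationaryMarkovChain p ν P) (i : ℤ) :
    P.map (fun x => x i) = ν := by
  have hs : Measurable fun (x : ℤ → S) (i : ℤ) => x (i + 1) :=
    measurable_pi_iff.2 fun _ => measurable_pi_apply _
  have hstep : ∀ i : ℤ, P.map (fun x => x (i + 1)) = P.map (fun x => x i) := by
    intro i
    conv_rhs => rw [← hP.stationary]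
    rw [Measure.map_map (measurable_pi_apply i) hs]
    rfl
  induction i with
  | zero => exact hP.marginal
  | succ n ih => rw [hstep, ih]
  | pred n ih => rw [← hstep, sub_add_cancel, ih]

/-- The joint law of two consecutive states of the stationary chain. -/
lemma IsStationaryMarkovChain.map_pair [IsProbabilityMeasure P] [IsMarkovKernel p]
    (hP : IsStationaryMarkovChain p ν P) (i : ℤ) :
    P.map (fun x => (x (i - 1), x i)) = ν ⊗ₘ p := by
  have hm : Measurable fun x : ℤ → S => (x (i - 1), x i) := by fun_prop
  have hν : IsProbabilityMeasure ν := by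
    rw [← hP.marginal]
    exact Measure.isProbabilityMeasure_map (measurable_pi_apply 0).aemeasurable
  refine Measure.ext_prod fun {s t} hs ht => ?_
  rw [Measure.map_apply hm (hs.prod ht), Measure.compProd_apply_prod hs ht,
    ← hP.map_apply (i - 1), setLIntegral_map hs (p.measurable_coe ht) (measurable_pi_apply _)]
  have h := hP.markov (i - 1) ((fun x => x (i - 1)) ⁻¹' s) (measurable_apply_past le_rfl hs) t ht
  rw [sub_add_cancel] at h
  exact h

end Chain

/-! ### Coupling one-sided chains -/

section Coupling

variable {E : Type*} [MeasurableSpace E] {p : Kernel E E} {Q : Kernel (E × E) (ℕ → E × E)}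

lemma measurable_map_fst : Measurable fun (w : ℕ → E × E) n => (w n).1 :=
  measurable_pi_iff.2 fun _ => (measurable_pi_apply _).fst

lemma measurable_map_snd : Measurable fun (w : ℕ → E × E) n => (w n).2 :=
  measurable_pi_iff.2 fun _ => (measurable_pi_apply _).snd

/-- The law of the one-sided chain as a kernel in its starting point, read off from a coupling:
the first component of the coupling started on the diagonal. -/
noncomputable def chainKernel (Q : Kernel (E × E) (ℕ → E × E)) : Kernel E (ℕ → E) :=
  (Q.map fun w n => (w n).1).comap (fun x => (x, x)) (by fun_prop)

lemma isMarkovChainFrom_chainKernel (hQ : IsMarkovianCoupling p Q) (x : E) :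
    IsMarkovChainFrom p x (chainKernel Q x) := by
  rw [chainKernel, Kernel.comap_apply, Kernel.map_apply _ measurable_map_fst]
  exact hQ.left x x

lemma isMarkovKernel_chainKernel (hQ : IsMarkovianCoupling p Q) :
    IsMarkovKernel (chainKernel Q) :=
  ⟨fun x => (isMarkovChainFrom_chainKernel hQ x).isProbabilityMeasure⟩

lemma IsMarkovianCoupling.map_fst (hQ : IsMarkovianCoupling p Q) (x y : E) :
    (Q (x, y)).map (fun w n => (w n).1) = chainKernel Q x :=
  (hQ.left x y).unique (isMarkovChainFrom_chainKernel hQ x)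

lemma IsMarkovianCoupling.map_snd (hQ : IsMarkovianCoupling p Q) (x y : E) :
    (Q (x, y)).map (fun w n => (w n).2) = chainKernel Q y :=
  (hQ.right x y).unique (isMarkovChainFrom_chainKernel hQ y)

/-- The coupled pair whose first component starts at `z` and whose second component starts from a
`p`-step out of `x`. -/
noncomputable def stepCoupling (p : Kernel E E) (Q : Kernel (E × E) (ℕ → E × E)) (x z : E) :
    Measure (ℕ → E × E) :=
  Q.comap (fun y => (z, y)) measurable_prodMk_left ∘ₘ p x

lemma stepCoupling_map_fst [IsMarkovKernel p] (hQ : IsMarkovianCoupling p Q) (x z : E) :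
    (stepCoupling p Q x z).map (fun w n => (w n).1) = chainKernel Q z := by
  ext s hs
  rw [stepCoupling, Measure.map_comp _ _ measurable_map_fst,
    Measure.bind_apply hs (Kernel.aemeasurable _)]
  simp [Kernel.map_apply _ measurable_map_fst, hQ.map_fst]

lemma stepCoupling_map_snd (hQ : IsMarkovianCoupling p Q) (x z : E) :
    (stepCoupling p Q x z).map (fun w n => (w n).2) = chainKernel Q ∘ₘ p x := by
  rw [stepCoupling, Measure.map_comp _ _ measurable_map_snd]
  congr 1
  ext1 y
  rw [Kernel.map_apply _ measurable_map_snd, Kernel.comap_apply, hQ.map_snd]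

end Coupling

/-! ### The variance bound -/

section Metric

variable {E : Type*} [MetricSpace E] [MeasurableSpace E] {p : Kernel E E} {ν : Measure E}
  {Q : Kernel (E × E) (ℕ → E × E)}

/-- `stepDist p Q j x z` is the mean distance at time `j` of the coupled chains, one started at
`z` and the other one from a `p`-step out of `x`. -/
noncomputable def stepDist (p : Kernel E E) (Q : Kernel (E × E) (ℕ → E × E)) (j : ℕ) (x z : E) :
    ℝ≥0∞ :=
  ∫⁻ y, ∫⁻ w, edist (w j).1 (w j).2 ∂(Q (z, y)) ∂(p x)

lemma measurable_edist_of_dist (hdist : Measurable fun q : E × E => dist q.1 q.2) :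
    Measurable fun q : E × E => edist q.1 q.2 := by
  simp_rw [edist_dist]
  exact hdist.ennreal_ofReal

lemma measurableSingletonClass_of_dist (hdist : Measurable fun q : E × E => dist q.1 q.2) :
    MeasurableSingletonClass E := by
  refine ⟨fun x => ?_⟩
  have h : ({x} : Set E) = (fun y => dist y x) ⁻¹' {0} := by
    ext y
    simp
  rw [h]
  exact (hdist.comp measurable_prodMk_right) (measurableSet_singleton 0)

lemma measurable_lintegral_edist (hdist : Measurable fun q : E × E => dist q.1 q.2) (j : ℕ) :
    Measurable fun z : E × E => ∫⁻ w, edist (w j).1 (w j).2 ∂(Q z) :=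
  ((measurable_edist_of_dist hdist).comp (measurable_pi_apply j)).lintegral_kernel

lemma measurable_stepDist [IsMarkovKernel p] (hdist : Measurable fun q : E × E => dist q.1 q.2)
    (j : ℕ) : Measurable fun q : E × E => stepDist p Q j q.1 q.2 := by
  have h := Measurable.lintegral_kernel_prod_right' (κ := p.comap Prod.fst measurable_fst)
    (f := fun r : (E × E) × E => ∫⁻ w, edist (w j).1 (w j).2 ∂(Q (r.1.2, r.2)))
    ((measurable_lintegral_edist hdist j).comp (by fun_prop))
  exact h

lemma measurable_meanCouplingTime (hdist : Measurable fun q : E × E => dist q.1 q.2) :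
    Measurable fun z : E × E => meanCouplingTime Q z.1 z.2 := by
  have h : Measurable (couplingTime : (ℕ → E × E) → ℝ≥0∞) :=
    Measurable.tsum fun j => (measurable_edist_of_dist hdist).comp (measurable_pi_apply j)
  exact h.lintegral_kernel

lemma tsum_stepDist (hdist : Measurable fun q : E × E => dist q.1 q.2) (x z : E) :
    ∑' j, stepDist p Q j x z = ∫⁻ y, meanCouplingTime Q z y ∂(p x) := by
  have hd : ∀ j : ℕ, Measurable fun w : ℕ → E × E => edist (w j).1 (w j).2 := fun j =>
    (measurable_edist_of_dist hdist).comp (measurable_pi_apply j)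
  simp only [stepDist, meanCouplingTime, couplingTime]
  have hm : ∀ j : ℕ, Measurable fun y => ∫⁻ w, edist (w j).1 (w j).2 ∂(Q (z, y)) := fun j =>
    (measurable_lintegral_edist hdist j).comp measurable_prodMk_left
  rw [← lintegral_tsum fun j => (hm j).aemeasurable]
  exact lintegral_congr fun y => (lintegral_tsum fun j => (hd j).aemeasurable).symm

lemma lintegral_sq_tsum_stepDist (hdist : Measurable fun q : E × E => dist q.1 q.2) :
    ∫⁻ x, ∫⁻ z, (∑' j, stepDist p Q j x z) ^ 2 ∂(p x) ∂ν = couplingConst p ν Q := by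
  refine lintegral_congr fun x => lintegral_congr fun z => ?_
  have hm : Measurable fun y => meanCouplingTime Q z y :=
    (measurable_meanCouplingTime hdist).comp measurable_prodMk_left
  rw [tsum_stepDist hdist, sq, ← lintegral_mul_const _ hm]
  exact lintegral_congr fun y => (lintegral_const_mul _ hm).symm

lemma lintegral_stepCoupling (hdist : Measurable fun q : E × E => dist q.1 q.2) (j : ℕ)
    (x z : E) : ∫⁻ w, edist (w j).1 (w j).2 ∂(stepCoupling p Q x z) = stepDist p Q j x z := by
  have hd : Measurable fun w : ℕ → E × E => edist (w j).1 (w j).2 :=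
    (measurable_edist_of_dist hdist).comp (measurable_pi_apply j)
  rw [stepCoupling, Measure.lintegral_bind (Kernel.aemeasurable _) hd.aemeasurable]
  rfl

/-- The martingale increment at time `i` is controlled by the coupling: both conditional
expectations are averages over futures from time `i` on, and `stepCoupling` couples these. -/
lemma enorm_integral_resample_sub_le [IsMarkovKernel p]
    (hdist : Measurable fun q : E × E => dist q.1 q.2) (hQ : IsMarkovianCoupling p Q)
    {f : (ℤ → E) → ℝ} (hfm : Measurable f) (hfc : ContinuousAtInfinity f) (i : ℤ) (x : ℤ → E)
    (h₁ : Integrable f (resample (chainKernel Q) i x))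
    (h₂ : Integrable f (resample (chainKernel Q) (i - 1) x)) :
    ‖∫ y, f y ∂(resample (chainKernel Q) i x) - ∫ y, f y ∂(resample (chainKernel Q) (i - 1) x)‖ₑ ≤
      ∑' j : ℕ, lipConst f (i + j) * stepDist p Q j (x (i - 1)) (x i) := by
  have := isMarkovKernel_chainKernel hQ
  have := measurableSingletonClass_of_dist hdist
  set Γ := stepCoupling p Q (x (i - 1)) (x i)
  let g₁ : (ℕ → E × E) → ℤ → E := fun w => glue i x fun n => (w n).1
  let g₂ : (ℕ → E × E) → ℤ → E := fun w => glue i x fun n => (w n).2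
  have hg₁ : Measurable g₁ := (measurable_glue_right i x).comp measurable_map_fst
  have hg₂ : Measurable g₂ := (measurable_glue_right i x).comp measurable_map_snd
  have e₁ : resample (chainKernel Q) i x = Γ.map g₁ := by
    rw [resample_apply, ← stepCoupling_map_fst hQ (x (i - 1)) (x i),
      Measure.map_map (measurable_glue_right i x) measurable_map_fst]
    rfl
  have e₂ : resample (chainKernel Q) (i - 1) x = Γ.map g₂ := by
    rw [resample_sub_one_apply (isMarkovChainFrom_chainKernel hQ),
      ← stepCoupling_map_snd hQ (x (i - 1)) (x i),
      Measure.map_map (measurable_glue_right i x) measurable_map_snd]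
    rfl
  have hd : ∀ j : ℕ, Measurable fun w : ℕ → E × E => edist (w j).1 (w j).2 := fun j =>
    (measurable_edist_of_dist hdist).comp (measurable_pi_apply j)
  rw [e₁] at h₁ ⊢
  rw [e₂] at h₂ ⊢
  rw [integral_map hg₁.aemeasurable hfm.aestronglyMeasurable,
    integral_map hg₂.aemeasurable hfm.aestronglyMeasurable,
    ← integral_sub (f := fun w => f (g₁ w)) (g := fun w => f (g₂ w)) (h₁.comp_measurable hg₁)
      (h₂.comp_measurable hg₂)]
  calc ‖∫ w, f (g₁ w) - f (g₂ w) ∂Γ‖ₑ ≤ ∫⁻ w, ‖f (g₁ w) - f (g₂ w)‖ₑ ∂Γ :=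
        enorm_integral_le_lintegral_enorm _
    _ ≤ ∫⁻ w, ∑' j : ℕ, lipConst f (i + j) * edist (w j).1 (w j).2 ∂Γ := by
        refine lintegral_mono fun w => ?_
        rw [← edist_eq_enorm_sub]
        refine (hfc.edist_le_tsum (i := i) fun k hk => by
          simp only [g₁, g₂, glue_of_lt hk]).trans
          (le_of_eq (tsum_congr fun j => ?_))
        simp only [g₁, g₂, glue_add]
    _ = ∑' j : ℕ, lipConst f (i + j) * stepDist p Q j (x (i - 1)) (x i) := by
        rw [lintegral_tsum fun j => ((hd j).const_mul _).aemeasurable]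
        refine tsum_congr fun j => ?_
        rw [lintegral_const_mul _ (hd j), lintegral_stepCoupling hdist]

/-- The variance inequality. The products stay in `[0, ∞]` throughout, so the convention
`0 * ∞ = 0` needs no separate treatment. -/
theorem evariance_le_couplingConst_mul [IsMarkovKernel p]
    (hdist : Measurable fun q : E × E => dist q.1 q.2)
    {P : Measure (ℤ → E)} [IsProbabilityMeasure P] (hP : IsStationaryMarkovChain p ν P)
    (htail : TailTrivial P) (hQ : IsMarkovianCoupling p Q)
    {f : (ℤ → E) → ℝ} (hfm : Measurable f) (hfc : ContinuousAtInfinity f) (hf : MemLp f 2 P) :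
    evariance f P ≤ couplingConst p ν Q * lipNormSq f := by
  have hM := isMarkovKernel_chainKernel hQ
  have hK := isMarkovChainFrom_chainKernel hQ
  have hfi : Integrable f P := hf.integrable one_le_two
  have hν : IsProbabilityMeasure ν := by
    rw [← hP.marginal]
    exact Measure.isProbabilityMeasure_map (measurable_pi_apply 0).aemeasurable
  have hint : ∀ i : ℤ, ∀ᵐ x ∂P, Integrable f (resample (chainKernel Q) i x) := by
    intro i
    have h := resample_comp_restrict hK hP.markov (A := Set.univ) (i := i) MeasurableSet.univ
    rw [Measure.restrict_univ] at h
    exact Measure.ae_integrable_of_integrable_comp (κ := resample (chainKernel Q) i) (by rwa [h])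
  let G : ℤ → E × E → ℝ≥0∞ := fun i q =>
    (∑' j : ℕ, lipConst f (i + j) * stepDist p Q j q.1 q.2) ^ 2
  have hG : ∀ i, Measurable (G i) := fun i =>
    (Measurable.tsum fun j => (measurable_stepDist hdist j).const_mul _).pow_const 2
  have hincr : ∀ i : ℤ, ∫⁻ x, ‖(P[f | past i]) x - (P[f | past (i - 1)]) x‖ₑ ^ 2 ∂P ≤
      ∫⁻ x, ∫⁻ z, G i (x, z) ∂(p x) ∂ν := by
    intro i
    calc ∫⁻ x, ‖(P[f | past i]) x - (P[f | past (i - 1)]) x‖ₑ ^ 2 ∂P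
        ≤ ∫⁻ x, G i (x (i - 1), x i) ∂P := by
          refine lintegral_mono_ae ?_
          filter_upwards [condExp_past_ae_eq hK hP.markov i hfm hfi,
            condExp_past_ae_eq hK hP.markov (i - 1) hfm hfi, hint i, hint (i - 1)] with x a b c d
          rw [a, b]
          exact pow_le_pow_left' (enorm_integral_resample_sub_le hdist hQ hfm hfc i x c d) 2
      _ = ∫⁻ x, ∫⁻ z, G i (x, z) ∂(p x) ∂ν := by
          rw [← Measure.lintegral_compProd (hG i), ← hP.map_pair i,
            lintegral_map (hG i) (by fun_prop)]
  have hmG : ∀ (i : ℤ) (x : E), Measurable fun z => G i (x, z) := fun i x =>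
    (hG i).comp measurable_prodMk_left
  calc evariance f P
      ≤ ∑' i : ℤ, ∫⁻ x, ‖(P[f | past i]) x - (P[f | past (i - 1)]) x‖ₑ ^ 2 ∂P :=
        evariance_le_tsum_condExp_sub past_mono past_le iSup_past htail hfm hf
    _ ≤ ∑' i : ℤ, ∫⁻ x, ∫⁻ z, G i (x, z) ∂(p x) ∂ν := ENNReal.tsum_le_tsum hincr
    _ = ∫⁻ x, ∫⁻ z, ∑' i : ℤ, G i (x, z) ∂(p x) ∂ν := by
        rw [← lintegral_tsum fun i => ((hG i).lintegral_kernel_prod_right' (κ := p)).aemeasurable]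
        exact lintegral_congr fun x => (lintegral_tsum fun i => (hmG i x).aemeasurable).symm
    _ ≤ ∫⁻ x, ∫⁻ z, (∑' j, stepDist p Q j x z) ^ 2 * lipNormSq f ∂(p x) ∂ν :=
        lintegral_mono fun x => lintegral_mono fun z =>
          tsum_sq_tsum_mul_le (lipConst f) fun j => stepDist p Q j x z
    _ = couplingConst p ν Q * lipNormSq f := by
        have hm : Measurable fun q : E × E => (∑' j, stepDist p Q j q.1 q.2) ^ 2 :=
          (Measurable.tsum fun j => measurable_stepDist hdist j).pow_const 2
        rw [← lintegral_sq_tsum_stepDist hdist,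
          ← lintegral_mul_const _ (hm.lintegral_kernel_prod_right' (κ := p))]
        exact lintegral_congr fun x => lintegral_mul_const _ (hm.comp measurable_prodMk_left)

end Metric

end CouplingConcentration

theorem theorem1 {E : Type*} [MetricSpace E] [MeasurableSpace E]
    (hdist : Measurable (fun q : E × E => dist q.1 q.2))
    (p : Kernel E E) [IsMarkovKernel p]
    (ν : Measure E)
    (P : Measure (ℤ → E)) [IsProbabilityMeasure P]
    (hP : CouplingConcentration.IsStationaryMarkovChain p ν P)
    (htail : CouplingConcentration.TailTrivial P)
    (Q : Kernel (E × E) (ℕ → E × E))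
    (hQ : CouplingConcentration.IsMarkovianCoupling p Q)
    (f : (ℤ → E) → ℝ) (hfm : Measurable f)
    (hfL : CouplingConcentration.IsCoordLipschitz f)
    (hfc : CouplingConcentration.ContinuousAtInfinity f)
    (hf2 : MemLp f 2 P) :
    evariance f P ≤
        CouplingConcentration.couplingConst p ν Q * CouplingConcentration.lipNormSq f ∧
      ∀ t : ℝ, 0 < t →
        P {x | t ≤ |f x - ∫ y, f y ∂P|} ≤
          CouplingConcentration.couplingConst p ν Q * CouplingConcentration.lipNormSq f /
            ENNReal.ofReal (t ^ 2) := by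
  have hvar := CouplingConcentration.evariance_le_couplingConst_mul hdist hP htail hQ hfm hfc hf2
  refine ⟨hvar, fun t ht => ?_⟩
  have h := meas_ge_le_evariance_div_sq hf2.1 (c := t.toNNReal) (by simpa using ht)
  rw [Real.coe_toNNReal t ht.le] at h
  refine h.trans ?_
  rw [ENNReal.ofReal_pow ht.le]
  exact ENNReal.div_le_div_right hvar _
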